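/- For positive integers $s_1,\dots,s_r$ with $s_1>1$ let $$\zeta^\star(s_1,\dots,s_r)=\sum_{k_1\ge\cdots\ge k_r\ge1}\frac{1}{k_1^{s_1}\cdots k_r^{s_r}}$$ be the (convergent) multiple zeta star value, let $\{2\}^a$ denote $a$ successive entries equal to $2$, and let $B_n$ be the Bernoulli numbers. Then for each positive integer $m$, $$\zeta^\star(\{2\}^{m-1},3,\{2\}^{m-1},1)=2\pi^{4m}\left(\frac{(1-2^{2m-1})B_{2m}}{(2m)!}\right)^2,$$ $$\zeta^\star(\{2\}^{m-1},3,\{2\}^{m-1},1,\{2\}^m)=(-1)^{m+1}\frac{\pi^{6m}}{3}\left(\frac{(2^{2m}-2)^3B_{2m}^3}{2\cdot(2m)!^3}+\frac{(2^{6m}-2)B_{6m}}{(6m)!}\right),$$ $$\zeta^\star(\{2\}^{m-1},3,\{2\}^{m-1},1,\{2\}^{m-1},3,\{2\}^{m-1},1)=\frac{(2-2^{2m})B_{2m}\,\pi^{8m}}{3\cdot(2m)!}\left(\frac{(1-2^{2m-1})^3B_{2m}^3}{(2m)!^3}+\frac{(2-2^{6m})B_{6m}}{(6m)!}\right).$$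 -/

import Mathlib

/-- The index set `k₁ ≥ k₂ ≥ ⋯ ≥ k_r ≥ 1` of the series of a multiple zeta star value of depth
`r`. -/
abbrev StarIndex (r : ℕ) : Type := {k : Fin r → ℕ+ // Antitone k}

/-- The term `1 / (k₁ ^ s₁ ⋯ k_r ^ s_r)` of the series of `ζ⋆(s₁, …, s_r)`. -/
noncomputable def mzsvTerm (s : List ℕ) (k : StarIndex s.length) : ℝ :=
  1 / ∏ i : Fin s.length, ((k.1 i : ℕ) : ℝ) ^ s.get i

/-- The multiple zeta star value `ζ⋆(s₁, …, s_r)`. -/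
noncomputable def mzsv (s : List ℕ) : ℝ :=
  ∑' k : StarIndex s.length, mzsvTerm s k

/-- The string `{2}^{m-1}, 3, {2}^{m-1}, 1` (used for `m ≥ 1`). -/
def block321 (m : ℕ) : List ℕ :=
  List.replicate (m - 1) 2 ++ [3] ++ List.replicate (m - 1) 2 ++ [1]

open Filter Topology

/-! Write K(n,k) = n!²/((n-k)!(n+k)!). Each truncated star sum that is needed equals ∑_{k≤n} g(k)
K(n,k), and prepending an entry to the string acts on g alone: 2 divides by k², while 1 and 3 bring
in partial sums of g, plain and alternating, through summation by parts. With x_k = (-1)^k/k^{2m},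
the block {2}^{m-1},3,{2}^{m-1},1 then acts as the square of g ↦ x_k(g_k + 2∑_{j<k} g_j)
(`IsKernelRep.block321_append`). As n → ∞ the kernel tends to 1, so the star value is ∑ g(k)
(`tendsto_kernelSum`). Starting from the empty string or from {2}^m, this sum is a polynomial in p₁
= ∑ x_k and p₃ = ∑ x_k³ (`sum_stepOp_one`, `sum_stepOp_two`, `sum_stepOp_three`). Both are
alternating zeta values, with exponents 2m and 6m, and Euler's formula evaluates them
(`hasSum_altTerm`). -/

/-- The truncated multiple harmonic star sum `∑_{n ≥ k₁ ≥ ⋯ ≥ k_r ≥ 1} 1 / (k₁ ^ s₁ ⋯ k_r ^ s_r)`. -/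
noncomputable def starSum : List ℕ → ℕ → ℝ
  | [], _ => 1
  | s :: l, n => ∑ i ∈ Finset.range n, 1 / ((i + 1 : ℕ) : ℝ) ^ s * starSum l (i + 1)

lemma starSum_nonneg (l : List ℕ) (n : ℕ) : 0 ≤ starSum l n := by
  induction l generalizing n with
  | nil => simp [starSum]
  | cons s l ih =>
    exact Finset.sum_nonneg fun i _ => mul_nonneg (by positivity) (ih _)

/-! ### Multiple zeta star values as limits of truncated sums -/

lemma hasSum_prod_of_nonneg {α β : Type*} {f : α × β → ℝ} {g : α → ℝ} {s : ℝ}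
    (hf : ∀ p, 0 ≤ f p) (hg : ∀ a, HasSum (fun b => f (a, b)) (g a)) (hs : HasSum g s) :
    HasSum f s := by
  have hsum : Summable f := by
    refine (summable_prod_of_nonneg hf).2 ⟨fun a => (hg a).summable, ?_⟩
    simpa only [(hg _).tsum_eq] using hs.summable
  have h := hsum.hasSum.prod_fiberwise hg
  rw [← h.unique hs]
  exact hsum.hasSum

lemma mzsvTerm_nonneg (s : List ℕ) (k : StarIndex s.length) : 0 ≤ mzsvTerm s k := by
  unfold mzsvTerm
  positivity

/-- Splitting off the first index of a weakly decreasing tuple. -/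
def starIndexSplit (r : ℕ) (k : StarIndex (r + 1)) : ℕ+ × StarIndex r :=
  (k.1 0, ⟨fun i => k.1 i.succ, fun _ _ h => k.2 (Fin.succ_le_succ_iff.2 h)⟩)

lemma starIndexSplit_injective (r : ℕ) : Function.Injective (starIndexSplit r) := by
  intro k k' h
  simp only [starIndexSplit, Prod.mk.injEq] at h
  apply Subtype.ext
  funext i
  refine Fin.cases h.1 (fun j => ?_) i
  exact congrFun (congrArg Subtype.val h.2) j

lemma mem_range_starIndexSplit {r : ℕ} (p : ℕ+ × StarIndex r) (h : ∀ i, p.2.1 i ≤ p.1) :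
    p ∈ Set.range (starIndexSplit r) := by
  obtain ⟨a, k⟩ := p
  refine ⟨⟨Fin.cons a k.1, ?_⟩, ?_⟩
  · intro i j
    refine Fin.cases ?_ (fun i => ?_) i <;> refine Fin.cases ?_ (fun j => ?_) j
    · simp
    · intro _
      simpa using h j
    · intro hij
      simp at hij
    · intro hij
      simpa using k.2 (Fin.succ_le_succ_iff.1 hij)
  · simp [starIndexSplit]

lemma mzsvTerm_cons (s : ℕ) (l : List ℕ) (k : StarIndex (s :: l).length) :
    mzsvTerm (s :: l) k =
      1 / ((k.1 0 : ℕ) : ℝ) ^ s * mzsvTerm l (starIndexSplit l.length k).2 := by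
  unfold mzsvTerm
  simp only [List.length_cons, starIndexSplit]
  rw [Fin.prod_univ_succ, one_div_mul_one_div]
  rfl

/-- The weight `w` on the first index serves two purposes: the indicator of k₁ ≤ N gives the
truncated sums, and the constant 1 the full series. -/
lemma hasSum_mzsvTerm_cons (s : ℕ) (l : List ℕ) {w : ℕ+ → ℝ} (hw : ∀ a, 0 ≤ w a) {L : ℝ}
    (hl : ∀ N : ℕ, HasSum (fun k : StarIndex l.length =>
      if ∀ i, (k.1 i : ℕ) ≤ N then mzsvTerm l k else 0) (starSum l N))
    (hL : HasSum (fun a : ℕ+ => w a * (1 / ((a : ℕ) : ℝ) ^ s * starSum l a)) L) :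
    HasSum (fun k : StarIndex (s :: l).length => w (k.1 0) * mzsvTerm (s :: l) k) L := by
  let F : ℕ+ × StarIndex l.length → ℝ := fun p =>
    w p.1 * (1 / ((p.1 : ℕ) : ℝ) ^ s *
      if ∀ i, (p.2.1 i : ℕ) ≤ (p.1 : ℕ) then mzsvTerm l p.2 else 0)
  have hF : HasSum F L := by
    refine hasSum_prod_of_nonneg (fun p => ?_) (fun a => ?_) hL
    · refine mul_nonneg (hw _) (mul_nonneg (by positivity) ?_)
      split_ifs
      · exact mzsvTerm_nonneg _ _
      · exact le_rfl
    · exact ((hl a).mul_left _).mul_left _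
  have h := ((starIndexSplit_injective l.length).hasSum_iff (f := F) (a := L) ?_).2 hF
  · have e : (fun k : StarIndex (s :: l).length => w (k.1 0) * mzsvTerm (s :: l) k) =
        F ∘ starIndexSplit l.length := by
      funext k
      rw [mzsvTerm_cons]
      have : ∀ i, (((starIndexSplit l.length k).2.1 i : ℕ+) : ℕ) ≤
          ((starIndexSplit l.length k).1 : ℕ) := fun i => k.2 (Fin.zero_le _)
      simp only [F, Function.comp, if_pos this]
      rfl
    rw [e]
    exact h
  · intro p hp
    have : ¬ ∀ i, (p.2.1 i : ℕ) ≤ (p.1 : ℕ) := fun h => hp (mem_range_starIndexSplit p h)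
    simp only [F, if_neg this, mul_zero]

lemma hasSum_mzsvTerm_truncated (l : List ℕ) (N : ℕ) :
    HasSum (fun k : StarIndex l.length =>
      if ∀ i, (k.1 i : ℕ) ≤ N then mzsvTerm l k else 0) (starSum l N) := by
  induction l generalizing N with
  | nil =>
    have : Unique (StarIndex ([] : List ℕ).length) :=
      ⟨⟨⟨fun i => i.elim0, fun i => i.elim0⟩⟩, fun k => Subtype.ext (funext fun i => i.elim0)⟩
    simp [starSum, mzsvTerm]
  | cons s l ih =>
    have h := hasSum_mzsvTerm_cons s l (w := fun a => if (a : ℕ) ≤ N then 1 else 0)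
      (L := starSum (s :: l) N) (fun a => by split_ifs <;> norm_num) ih ?_
    · convert h using 1
      funext k
      by_cases hk : (k.1 0 : ℕ) ≤ N
      · have : ∀ i, (k.1 i : ℕ) ≤ N := fun i => le_trans (k.2 (Fin.zero_le i)) hk
        rw [if_pos this, if_pos hk, one_mul]
      · rw [if_neg (fun h => hk (h _)), if_neg hk, zero_mul]
    · rw [← Equiv.pnatEquivNat.symm.hasSum_iff]
      have e : starSum (s :: l) N = ∑ i ∈ Finset.range N, ((fun a : ℕ+ =>
          (if (a : ℕ) ≤ N then (1 : ℝ) else 0) * (1 / ((a : ℕ) : ℝ) ^ s * starSum l a)) ∘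
            Equiv.pnatEquivNat.symm) i := by
        rw [starSum]
        refine Finset.sum_congr rfl fun i hi => ?_
        have : i + 1 ≤ N := Finset.mem_range.1 hi
        simp [Equiv.pnatEquivNat, this]
      rw [e]
      apply hasSum_sum_of_ne_finset_zero
      · intro i hi
        have : ¬ i + 1 ≤ N := fun h => hi (Finset.mem_range.2 h)
        simp [Equiv.pnatEquivNat, this]

lemma hasSum_mzsvTerm_of_tendsto (s : ℕ) (l : List ℕ) {L : ℝ}
    (h : Tendsto (starSum (s :: l)) atTop (𝓝 L)) : HasSum (mzsvTerm (s :: l)) L := by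
  have h' := hasSum_mzsvTerm_cons s l (w := fun _ => 1) (L := L) (fun _ => zero_le_one)
    (hasSum_mzsvTerm_truncated l) ?_
  · simpa using h'
  · rw [← Equiv.pnatEquivNat.symm.hasSum_iff]
    refine (hasSum_iff_tendsto_nat_of_nonneg (fun i => ?_) _).2 ?_
    · exact mul_nonneg zero_le_one (mul_nonneg (by positivity) (starSum_nonneg _ _))
    · convert h using 2 with n
      rw [starSum]
      refine Finset.sum_congr rfl fun i _ => ?_
      simp [Equiv.pnatEquivNat]

/-! ### The binomial kernel -/

/-- The ratio `n! ^ 2 / ((n - k)! (n + k)!)`, which vanishes for `k > n`. -/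
noncomputable def binomKernel (n : ℕ) : ℕ → ℝ
  | 0 => 1
  | k + 1 => binomKernel n k * ((n : ℝ) - k) / (n + k + 1)

lemma binomKernel_succ_mul (n k : ℕ) :
    binomKernel n (k + 1) * ((n : ℝ) + k + 1) = binomKernel n k * ((n : ℝ) - k) := by
  have : (n : ℝ) + k + 1 ≠ 0 := by positivity
  rw [binomKernel, div_mul_cancel₀ _ this]

lemma binomKernel_eq_zero {n k : ℕ} (h : n < k) : binomKernel n k = 0 := by
  induction k, h using Nat.le_induction with
  | base => simp [binomKernel]
  | succ k _ ih => simp [binomKernel, ih]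

lemma binomKernel_mem_Icc (n k : ℕ) : 0 ≤ binomKernel n k ∧ binomKernel n k ≤ 1 := by
  induction k with
  | zero => simp [binomKernel]
  | succ k ih =>
    rcases lt_or_ge n (k + 1) with h | h
    · rw [binomKernel_eq_zero h]
      norm_num
    · have hk : (k : ℝ) + 1 ≤ n := by exact_mod_cast h
      have hpos : (0 : ℝ) < n + k + 1 := by positivity
      have hk0 : (0 : ℝ) ≤ k := by positivity
      rw [binomKernel]
      refine ⟨div_nonneg (mul_nonneg ih.1 (by linarith)) hpos.le, ?_⟩
      rw [div_le_one hpos]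
      calc binomKernel n k * ((n : ℝ) - k) ≤ 1 * ((n : ℝ) - k) :=
            mul_le_mul_of_nonneg_right ih.2 (by linarith)
        _ ≤ n + k + 1 := by linarith

lemma tendsto_binomKernel (k : ℕ) : Tendsto (fun n => binomKernel n k) atTop (𝓝 1) := by
  induction k with
  | zero => simp [binomKernel]
  | succ k ih =>
    have h : Tendsto (fun n : ℕ => 1 - (2 * (k : ℝ) + 1) / ((n : ℝ) + (k + 1))) atTop
        (𝓝 (1 - 0)) := by
      refine tendsto_const_nhds.sub (tendsto_const_nhds.div_atTop ?_)
      exact tendsto_atTop_add_const_right _ _ tendsto_natCast_atTop_atTop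
    have h2 := ih.mul h
    rw [sub_zero, mul_one] at h2
    refine h2.congr fun n => ?_
    have : (n : ℝ) + k + 1 ≠ 0 := by positivity
    have : (n : ℝ) + (k + 1) ≠ 0 := by positivity
    rw [binomKernel]
    field_simp
    ring

lemma binomKernel_pred_mul (n k : ℕ) :
    binomKernel n k * ((n : ℝ) + 1) ^ 2 =
      binomKernel (n + 1) k * (((n : ℝ) + 1) ^ 2 - (k : ℝ) ^ 2) := by
  induction k with
  | zero => simp [binomKernel]
  | succ k ih =>
    have h1 : (n : ℝ) + k + 1 ≠ 0 := by positivity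
    have h2 : (n : ℝ) + 1 + k + 1 ≠ 0 := by positivity
    rw [binomKernel, binomKernel]
    push_cast
    field_simp
    linear_combination ((n : ℝ) - k) * ((n : ℝ) + 1 + k + 1) * ih

/-- The transform `∑_{k = 1}^n g(k) binomKernel n k`, the sequence `g` being indexed by `k - 1`. -/
noncomputable def kernelSum (g : ℕ → ℝ) (n : ℕ) : ℝ :=
  ∑ i ∈ Finset.range n, g i * binomKernel n (i + 1)

/-- From K(n-1,k) n² = K(n,k)(n² - k²): differencing in n multiplies g(k) by k²/n². Hence prepending
2 is division by k². -/
lemma kernelSum_succ_sub (g : ℕ → ℝ) (n : ℕ) :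
    (kernelSum g (n + 1) - kernelSum g n) * ((n : ℝ) + 1) ^ 2 =
      kernelSum (fun i => ((i : ℝ) + 1) ^ 2 * g i) (n + 1) := by
  have h : kernelSum g n = ∑ i ∈ Finset.range (n + 1), g i * binomKernel n (i + 1) := by
    rw [Finset.sum_range_succ, binomKernel_eq_zero (Nat.lt_succ_self n), mul_zero, add_zero]
    rfl
  rw [h]
  unfold kernelSum
  rw [← Finset.sum_sub_distrib, Finset.sum_mul]
  refine Finset.sum_congr rfl fun i _ => ?_
  have := binomKernel_pred_mul n (i + 1)
  push_cast at this
  linear_combination (-g i) * this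

/-- Summation by parts against the binomial kernel. -/
lemma kernelSum_mul_add (G : ℕ → ℝ) (n : ℕ) :
    kernelSum (fun i => ((i : ℝ) + 1) * (G (i + 1) + G i)) n =
      n * kernelSum (fun i => G (i + 1) - G i) n + n * G 0 := by
  -- The sum telescopes, and its boundary term vanishes at j = n thanks to the factor n - j.
  have key : ∀ j : ℕ, ∑ i ∈ Finset.range j,
      (((i : ℝ) + 1) * (G (i + 1) + G i) - n * (G (i + 1) - G i)) * binomKernel n (i + 1) =
      n * G 0 - ((n : ℝ) - j) * binomKernel n j * G j := by
    intro j
    induction j with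
    | zero => simp [binomKernel]
    | succ j ih =>
      rw [Finset.sum_range_succ, ih]
      have := binomKernel_succ_mul n j
      push_cast
      linear_combination G j * this
  have h := key n
  unfold kernelSum
  rw [sub_self, zero_mul, zero_mul, sub_zero] at h
  simp only [sub_mul, Finset.sum_sub_distrib, mul_assoc, ← Finset.mul_sum] at h ⊢
  linarith

/-! ### Kernel representations of truncated star sums -/

/-- `g` represents the truncated star sums of `l` through the binomial kernel. -/
def IsKernelRep (l : List ℕ) (g : ℕ → ℝ) : Prop :=
  ∀ n : ℕ, starSum l (n + 1) = kernelSum g (n + 1)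

/-- By `kernelSum_succ_sub`, `H` says with denominators cleared that both sides have the same
increments in n. -/
lemma starSum_cons_eq_kernelSum {s : ℕ} {l : List ℕ} {g h : ℕ → ℝ} (hg : IsKernelRep l g)
    (H : ∀ n : ℕ, ((n : ℝ) + 1) ^ s * kernelSum (fun i => ((i : ℝ) + 1) ^ 2 * h i) (n + 1) =
      ((n : ℝ) + 1) ^ 2 * kernelSum g (n + 1)) (n : ℕ) :
    starSum (s :: l) n = kernelSum h n := by
  induction n with
  | zero => simp [starSum, kernelSum]
  | succ n ih =>
    have e : starSum (s :: l) (n + 1) =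
        starSum (s :: l) n + 1 / ((n + 1 : ℕ) : ℝ) ^ s * starSum l (n + 1) := by
      simp only [starSum, Finset.sum_range_succ]
    rw [e, ih, hg n]
    have h0 : (n : ℝ) + 1 ≠ 0 := by positivity
    have h1 := H n
    rw [← kernelSum_succ_sub] at h1
    have h2 : ((n : ℝ) + 1) ^ s * (kernelSum h (n + 1) - kernelSum h n) =
        kernelSum g (n + 1) := by
      apply mul_left_cancel₀ (pow_ne_zero 2 h0)
      linear_combination h1
    push_cast
    rw [← h2, one_div, inv_mul_cancel_left₀ (pow_ne_zero s h0)]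
    ring

lemma IsKernelRep.cons {s : ℕ} {l : List ℕ} {g h : ℕ → ℝ} (hg : IsKernelRep l g)
    (H : ∀ n : ℕ, ((n : ℝ) + 1) ^ s * kernelSum (fun i => ((i : ℝ) + 1) ^ 2 * h i) (n + 1) =
      ((n : ℝ) + 1) ^ 2 * kernelSum g (n + 1)) : IsKernelRep (s :: l) h :=
  fun n => starSum_cons_eq_kernelSum hg H (n + 1)

/-- Summation by parts with G(i) = (-1)^i, for which G(i+1) + G(i) = 0. The identity fails at n = 0,
where the kernel sum is empty; hence the shift to n + 1 in `IsKernelRep`. -/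
lemma isKernelRep_nil : IsKernelRep [] fun i => -2 * (-1) ^ (i + 1) := by
  intro n
  have h := kernelSum_mul_add (fun i => (-1) ^ i) (n + 1)
  have h0 : ((n + 1 : ℕ) : ℝ) ≠ 0 := by positivity
  have e1 : (fun i : ℕ => ((i : ℝ) + 1) * ((-1) ^ (i + 1) + (-1) ^ i)) = fun _ => 0 := by
    funext i
    ring
  have e2 : (fun i : ℕ => (-1 : ℝ) ^ (i + 1) - (-1) ^ i) =
      fun i => -(-2 * (-1) ^ (i + 1)) := by
    funext i
    ring
  rw [e1, e2] at h
  simp only [kernelSum, zero_mul, Finset.sum_const_zero, neg_mul, Finset.sum_neg_distrib,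
    pow_zero] at h
  simp only [starSum, kernelSum, neg_mul, Finset.sum_neg_distrib]
  apply mul_left_cancel₀ h0
  linarith

lemma IsKernelRep.cons_two {l : List ℕ} {g : ℕ → ℝ} (hg : IsKernelRep l g) :
    IsKernelRep (2 :: l) fun i => g i / ((i : ℝ) + 1) ^ 2 := by
  refine hg.cons fun n => ?_
  congr 2
  funext i
  have : (i : ℝ) + 1 ≠ 0 := by positivity
  field_simp

lemma IsKernelRep.replicate_two_append {l : List ℕ} {g : ℕ → ℝ} (hg : IsKernelRep l g) (a : ℕ) :
    IsKernelRep (List.replicate a 2 ++ l) fun i => g i / ((i : ℝ) + 1) ^ (2 * a) := by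
  induction a with
  | zero => simpa using hg
  | succ a ih =>
    rw [List.replicate_succ, List.cons_append]
    convert ih.cons_two using 1
    funext i
    rw [div_div]
    ring

lemma IsKernelRep.cons_one {l : List ℕ} {g : ℕ → ℝ} (hg : IsKernelRep l g) :
    IsKernelRep (1 :: l) fun i => (g i + 2 * ∑ j ∈ Finset.range i, g j) / ((i : ℝ) + 1) := by
  refine hg.cons fun n => ?_
  have h := kernelSum_mul_add (fun i => ∑ j ∈ Finset.range i, g j) (n + 1)
  simp only [Finset.sum_range_succ, Finset.sum_range_zero, mul_zero, add_zero,
    add_sub_cancel_left] at h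
  have e : (fun i : ℕ => ((i : ℝ) + 1) ^ 2 *
      ((g i + 2 * ∑ j ∈ Finset.range i, g j) / ((i : ℝ) + 1))) =
      fun i : ℕ => ((i : ℝ) + 1) * (∑ j ∈ Finset.range i, g j + g i +
        ∑ j ∈ Finset.range i, g j) := by
    funext i
    have : (i : ℝ) + 1 ≠ 0 := by positivity
    field_simp
    ring
  rw [e, h]
  push_cast
  ring

lemma IsKernelRep.cons_three {l : List ℕ} {g : ℕ → ℝ} (hg : IsKernelRep l g) :
    IsKernelRep (3 :: l) fun i => (g i / ((i : ℝ) + 1) + 2 * (-1) ^ (i + 1) *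
      ∑ j ∈ Finset.range i, (-1) ^ (j + 1) * (g j / ((j : ℝ) + 1))) / ((i : ℝ) + 1) ^ 2 := by
  refine hg.cons fun n => ?_
  -- This G solves k (G(k) + G(k-1)) = g_k with G(0) = 0, so summation by parts now divides by n
  -- instead of multiplying by it.
  have h := kernelSum_mul_add (fun i => (-1) ^ i *
    ∑ j ∈ Finset.range i, (-1) ^ (j + 1) * (g j / ((j : ℝ) + 1))) (n + 1)
  have sq : ∀ i : ℕ, (-1 : ℝ) ^ i * (-1) ^ i = 1 := fun i => by
    rw [← mul_pow]
    norm_num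
  have e1 : (fun i : ℕ => ((i : ℝ) + 1) *
      ((-1) ^ (i + 1) * ∑ j ∈ Finset.range (i + 1), (-1) ^ (j + 1) * (g j / ((j : ℝ) + 1)) +
        (-1) ^ i * ∑ j ∈ Finset.range i, (-1) ^ (j + 1) * (g j / ((j : ℝ) + 1)))) = g := by
    funext i
    have h0 : (i : ℝ) + 1 ≠ 0 := by positivity
    have h1 : ((i : ℝ) + 1) * (g i / ((i : ℝ) + 1)) = g i := mul_div_cancel₀ _ h0
    rw [Finset.sum_range_succ, pow_succ]
    linear_combination ((i : ℝ) + 1) * (g i / ((i : ℝ) + 1)) * sq i + h1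
  have e2 : (fun i : ℕ => ((i : ℝ) + 1) ^ 2 * ((g i / ((i : ℝ) + 1) + 2 * (-1) ^ (i + 1) *
      ∑ j ∈ Finset.range i, (-1) ^ (j + 1) * (g j / ((j : ℝ) + 1))) / ((i : ℝ) + 1) ^ 2)) =
      fun i : ℕ => (-1) ^ (i + 1) *
        ∑ j ∈ Finset.range (i + 1), (-1) ^ (j + 1) * (g j / ((j : ℝ) + 1)) -
        (-1) ^ i * ∑ j ∈ Finset.range i, (-1) ^ (j + 1) * (g j / ((j : ℝ) + 1)) := by
    funext i
    have h0 : ((i : ℝ) + 1) ^ 2 ≠ 0 := by positivity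
    rw [mul_div_cancel₀ _ h0, Finset.sum_range_succ, pow_succ]
    linear_combination (-(g i / ((i : ℝ) + 1))) * sq i
  rw [e1] at h
  rw [e2, h]
  simp only [Finset.sum_range_zero, mul_zero, add_zero]
  push_cast
  ring

/-- The operator `g ↦ (k ↦ x_k (g_k + 2 ∑_{j < k} g_j))`. -/
noncomputable def stepOp (x g : ℕ → ℝ) (i : ℕ) : ℝ :=
  x i * (g i + 2 * ∑ j ∈ Finset.range i, g j)

/-- The terms `(-1) ^ k / k ^ (2 * m)`, indexed by `k - 1`. -/
noncomputable def altTerm (m i : ℕ) : ℝ := (-1) ^ (i + 1) / ((i : ℝ) + 1) ^ (2 * m)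

lemma IsKernelRep.block321_append {l : List ℕ} {g : ℕ → ℝ} (hg : IsKernelRep l g) {m : ℕ}
    (hm : 1 ≤ m) :
    IsKernelRep (block321 m ++ l) (stepOp (altTerm m) (stepOp (altTerm m) g)) := by
  obtain ⟨a, rfl⟩ : ∃ a, m = a + 1 := ⟨m - 1, by omega⟩
  have e : block321 (a + 1) ++ l =
      List.replicate a 2 ++ 3 :: (List.replicate a 2 ++ 1 :: l) := by
    simp [block321]
  rw [e]
  convert (hg.cons_one.replicate_two_append a).cons_three.replicate_two_append a using 1
  funext i
  have hy : ∀ j : ℕ, (-1) ^ (j + 1) * ((g j + 2 * ∑ j ∈ Finset.range j, g j) / ((j : ℝ) + 1) /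
      ((j : ℝ) + 1) ^ (2 * a) / ((j : ℝ) + 1)) = stepOp (altTerm (a + 1)) g j := by
    intro j
    have : (j : ℝ) + 1 ≠ 0 := by positivity
    rw [stepOp, altTerm, show 2 * (a + 1) = 2 * a + 1 + 1 by ring, pow_succ _ (2 * a + 1),
      pow_succ _ (2 * a)]
    field_simp
  simp only [hy]
  rw [stepOp, ← hy i, altTerm]
  have h0 : (i : ℝ) + 1 ≠ 0 := by positivity
  have sq : (-1 : ℝ) ^ (i + 1) * (-1) ^ (i + 1) = 1 := by
    rw [← mul_pow]
    norm_num
  rw [show 2 * (a + 1) = 2 + 2 * a by ring, pow_add _ 2 (2 * a), ← div_div, div_mul_eq_mul_div,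
    div_mul_eq_mul_div]
  congr 2
  linear_combination ((g i + 2 * ∑ j ∈ Finset.range i, g j) / ((i : ℝ) + 1) /
      ((i : ℝ) + 1) ^ (2 * a) / ((i : ℝ) + 1)) * sq

lemma isKernelRep_replicate_two (m : ℕ) :
    IsKernelRep (List.replicate m 2) fun i => -(2 * altTerm m i) := by
  have h := isKernelRep_nil.replicate_two_append m
  rw [List.append_nil] at h
  convert h using 1
  funext i
  rw [altTerm]
  ring

lemma isKernelRep_block321 {m : ℕ} (hm : 1 ≤ m) :
    IsKernelRep (block321 m) (stepOp (altTerm m) fun i => 2 * altTerm m i) := by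
  have h := isKernelRep_nil.block321_append hm
  rw [List.append_nil] at h
  convert h using 2
  funext i
  -- The partial sums cancel the alternating sign, so the operator sends the sequence of the empty
  -- string to 2x.
  have hs : ∀ i : ℕ, ∑ j ∈ Finset.range i, (-2 * (-1 : ℝ) ^ (j + 1)) = 1 - (-1) ^ i := by
    intro i
    induction i with
    | zero => simp
    | succ i ih =>
      rw [Finset.sum_range_succ, ih]
      ring
  rw [stepOp, hs]
  ring

/-! ### Passage to the limit -/

lemma tendsto_kernelSum {g : ℕ → ℝ} (hg : Summable fun i => |g i|) :
    Tendsto (kernelSum g) atTop (𝓝 (∑' i, g i)) := by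
  have h : Tendsto (fun n => ∑' i, g i * binomKernel n (i + 1)) atTop (𝓝 (∑' i, g i)) := by
    refine tendsto_tsum_of_dominated_convergence hg (fun i => ?_) (Eventually.of_forall ?_)
    · simpa using (tendsto_binomKernel (i + 1)).const_mul (g i)
    · intro n i
      rw [Real.norm_eq_abs, abs_mul, abs_of_nonneg (binomKernel_mem_Icc n _).1]
      exact mul_le_of_le_one_right (abs_nonneg _) (binomKernel_mem_Icc n _).2
  refine h.congr fun n => ?_
  refine tsum_eq_sum fun i hi => ?_
  rw [binomKernel_eq_zero, mul_zero]
  have := Finset.mem_range.not.1 hi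
  omega

lemma summable_abs_stepOp {x g : ℕ → ℝ} (hx : Summable fun i => |x i|)
    (hg : Summable fun i => |g i|) : Summable fun i => |stepOp x g i| := by
  refine Summable.of_nonneg_of_le (fun _ => abs_nonneg _) (fun i => ?_)
    (hx.mul_right (3 * ∑' j, |g j|))
  rw [stepOp, abs_mul]
  refine mul_le_mul_of_nonneg_left ?_ (abs_nonneg _)
  have h1 : |g i| ≤ ∑' j, |g j| := hg.le_tsum i fun _ _ => abs_nonneg _
  have h2 : |∑ j ∈ Finset.range i, g j| ≤ ∑' j, |g j| :=
    (Finset.abs_sum_le_sum_abs _ _).trans (hg.sum_le_tsum _ fun _ _ => abs_nonneg _)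
  calc |g i + 2 * ∑ j ∈ Finset.range i, g j|
      ≤ |g i| + |2 * ∑ j ∈ Finset.range i, g j| := abs_add_le _ _
    _ = |g i| + 2 * |∑ j ∈ Finset.range i, g j| := by rw [abs_mul, abs_two]
    _ ≤ 3 * ∑' j, |g j| := by linarith

lemma summable_abs_altTerm {m : ℕ} (hm : 1 ≤ m) : Summable fun i => |altTerm m i| := by
  have h : Summable fun n : ℕ => 1 / (n : ℝ) ^ (2 * m) :=
    Real.summable_one_div_nat_pow.2 (by omega)
  refine ((summable_nat_add_iff 1).2 h).congr fun i => ?_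
  rw [altTerm, abs_div, abs_pow, abs_neg, abs_one, one_pow, abs_of_nonneg (by positivity)]
  push_cast
  rfl

lemma hasSum_mzsvTerm_of_isKernelRep {l : List ℕ} (hl : l ≠ []) {g : ℕ → ℝ} {L : ℝ}
    (h : IsKernelRep l g) (hg : Summable fun i => |g i|)
    (hL : Tendsto (fun n => ∑ i ∈ Finset.range n, g i) atTop (𝓝 L)) :
    HasSum (mzsvTerm l) L := by
  obtain ⟨s, l, rfl⟩ := List.exists_cons_of_ne_nil hl
  apply hasSum_mzsvTerm_of_tendsto
  rw [← tendsto_nhds_unique hg.of_abs.hasSum.tendsto_sum_nat hL]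
  refine (tendsto_add_atTop_iff_nat 1).1 ?_
  refine ((tendsto_add_atTop_iff_nat 1).2 (tendsto_kernelSum hg)).congr fun n => (h n).symm

/-! ### Iterates of the operator in terms of power sums -/

lemma sum_range_stepOp_succ (x g : ℕ → ℝ) (n : ℕ) :
    ∑ i ∈ Finset.range (n + 1), stepOp x g i = ∑ i ∈ Finset.range n, stepOp x g i +
      x n * (∑ i ∈ Finset.range (n + 1), g i + ∑ i ∈ Finset.range n, g i) := by
  rw [Finset.sum_range_succ, Finset.sum_range_succ _ n, stepOp]
  ring

/-- The increments in `sum_range_stepOp_succ` are those of the coefficients of ∏(1 + x_i t)/(1 - x_i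
t) = exp(2(p₁t + p₃t³/3 + ⋯)); this and the next two lemmas read off t², t³ and t⁴. -/
lemma sum_stepOp_one (x : ℕ → ℝ) (n : ℕ) :
    ∑ i ∈ Finset.range n, stepOp x (fun i => 2 * x i) i =
      2 * (∑ i ∈ Finset.range n, x i) ^ 2 := by
  induction n with
  | zero => simp
  | succ n ih =>
    rw [sum_range_stepOp_succ, ih]
    simp only [← Finset.mul_sum, Finset.sum_range_succ]
    ring

lemma sum_stepOp_two (x : ℕ → ℝ) (n : ℕ) :
    ∑ i ∈ Finset.range n, stepOp x (stepOp x fun i => 2 * x i) i =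
      4 / 3 * (∑ i ∈ Finset.range n, x i) ^ 3 + 2 / 3 * ∑ i ∈ Finset.range n, x i ^ 3 := by
  induction n with
  | zero => simp
  | succ n ih =>
    rw [sum_range_stepOp_succ, ih, sum_stepOp_one, sum_stepOp_one]
    simp only [Finset.sum_range_succ]
    ring

lemma sum_stepOp_three (x : ℕ → ℝ) (n : ℕ) :
    ∑ i ∈ Finset.range n, stepOp x (stepOp x (stepOp x fun i => 2 * x i)) i =
      2 / 3 * (∑ i ∈ Finset.range n, x i) ^ 4 +
        4 / 3 * (∑ i ∈ Finset.range n, x i) * ∑ i ∈ Finset.range n, x i ^ 3 := by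
  induction n with
  | zero => simp
  | succ n ih =>
    rw [sum_range_stepOp_succ, ih, sum_stepOp_two, sum_stepOp_two]
    simp only [Finset.sum_range_succ]
    ring

lemma stepOp_neg (x g : ℕ → ℝ) : stepOp x (fun i => -g i) = fun i => -stepOp x g i := by
  funext i
  simp only [stepOp, Finset.sum_neg_distrib]
  ring

/-! ### Alternating zeta values -/

lemma altTerm_pow_three (m i : ℕ) : altTerm m i ^ 3 = altTerm (3 * m) i := by
  rw [altTerm, altTerm, div_pow, ← pow_mul, ← pow_mul, pow_mul' (-1 : ℝ) (i + 1) 3]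
  norm_num
  ring

lemma hasSum_altTerm {m : ℕ} (hm : 1 ≤ m) :
    HasSum (altTerm m) ((-1) ^ m * ((2 ^ (2 * m) - 2) * (bernoulli (2 * m) : ℝ) /
      ((2 * m).factorial : ℝ)) * Real.pi ^ (2 * m) / 2) := by
  have hz := hasSum_zeta_nat (k := m) (by omega)
  set Z : ℝ := (-1) ^ (m + 1) * 2 ^ (2 * m - 1) * Real.pi ^ (2 * m) * (bernoulli (2 * m) : ℝ) /
    ((2 * m).factorial : ℝ) with hZ
  have he : HasSum (fun n : ℕ => if Even n then 1 / (n : ℝ) ^ (2 * m) else 0)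
      (1 / 2 ^ (2 * m) * Z) := by
    have hinj : Function.Injective fun n : ℕ => 2 * n := fun a b h => by simpa using h
    refine (hinj.hasSum_iff ?_).1 ?_
    · intro n hn
      rw [if_neg]
      rintro ⟨a, rfl⟩
      exact hn ⟨a, two_mul a⟩
    · have e : ((fun n : ℕ => if Even n then 1 / (n : ℝ) ^ (2 * m) else 0) ∘ fun n => 2 * n) =
          fun n : ℕ => 1 / 2 ^ (2 * m) * (1 / (n : ℝ) ^ (2 * m)) := by
        funext n
        simp [mul_pow, mul_comm]
      rw [e]
      exact hz.mul_left _
  -- The alternating series is twice its even part minus the whole; the index 0, removed next,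
  -- contributes 1/0 = 0.
  have h := (he.mul_left 2).sub hz
  rw [← hasSum_nat_add_iff' 1] at h
  have h0 : (0 : ℝ) ^ (2 * m) = 0 := zero_pow (by omega)
  simp only [Finset.sum_range_one, Nat.cast_zero, h0, div_zero, ite_self, mul_zero,
    sub_zero] at h
  convert h using 1
  · rfl
  · funext i
    rw [altTerm]
    push_cast
    rcases Nat.even_or_odd (i + 1) with hi | hi
    · rw [if_pos hi, hi.neg_one_pow]
      ring
    · rw [if_neg (Nat.not_even_iff_odd.2 hi), hi.neg_one_pow]
      ring
  · have h2 : (2 : ℝ) ^ (2 * m) = 2 * 2 ^ (2 * m - 1) := by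
      rw [← pow_succ']
      congr 1
      omega
    have h3 : (2 : ℝ) ^ (2 * m - 1) ≠ 0 := by positivity
    have h4 : ((2 * m).factorial : ℝ) ≠ 0 := by positivity
    rw [hZ, h2, pow_succ (-1 : ℝ) m]
    field_simp
    ring

theorem mainTheorem8 (m : ℕ) (hm : 1 ≤ m) :
    (Summable (mzsvTerm (block321 m)) ∧
      mzsv (block321 m) =
        2 * Real.pi ^ (4 * m) *
          ((1 - 2 ^ (2 * m - 1)) * (bernoulli (2 * m) : ℝ) / ((2 * m).factorial : ℝ)) ^ 2) ∧
    (Summable (mzsvTerm (block321 m ++ List.replicate m 2)) ∧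
      mzsv (block321 m ++ List.replicate m 2) =
        (-1) ^ (m + 1) * (Real.pi ^ (6 * m) / 3) *
          ((2 ^ (2 * m) - 2) ^ 3 * (bernoulli (2 * m) : ℝ) ^ 3 /
              (2 * ((2 * m).factorial : ℝ) ^ 3) +
            (2 ^ (6 * m) - 2) * (bernoulli (6 * m) : ℝ) / ((6 * m).factorial : ℝ))) ∧
    (Summable (mzsvTerm (block321 m ++ block321 m)) ∧
      mzsv (block321 m ++ block321 m) =
        (2 - 2 ^ (2 * m)) * (bernoulli (2 * m) : ℝ) * Real.pi ^ (8 * m) /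
            (3 * ((2 * m).factorial : ℝ)) *
          ((1 - 2 ^ (2 * m - 1)) ^ 3 * (bernoulli (2 * m) : ℝ) ^ 3 /
              ((2 * m).factorial : ℝ) ^ 3 +
            (2 - 2 ^ (6 * m)) * (bernoulli (6 * m) : ℝ) / ((6 * m).factorial : ℝ))) := by
  have hx := summable_abs_altTerm hm
  have hx2 : Summable fun i => |2 * altTerm m i| := by
    simpa only [abs_mul] using hx.mul_left |2|
  have hp1 := (hasSum_altTerm hm).tendsto_sum_nat
  have hp3 := (hasSum_altTerm (m := 3 * m) (by omega)).tendsto_sum_nat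
  simp only [← altTerm_pow_three] at hp3
  have hne : block321 m ≠ [] := by simp [block321]
  have hR1 := hasSum_mzsvTerm_of_isKernelRep hne (isKernelRep_block321 hm)
    (summable_abs_stepOp hx hx2)
    (((hp1.pow 2).const_mul 2).congr fun n => (sum_stepOp_one _ n).symm)
  have hrep2 := (isKernelRep_replicate_two m).block321_append hm
  rw [stepOp_neg, stepOp_neg] at hrep2
  have hR2 := hasSum_mzsvTerm_of_isKernelRep (List.append_ne_nil_of_left_ne_nil hne _) hrep2
    (by simpa only [abs_neg] using summable_abs_stepOp hx (summable_abs_stepOp hx hx2))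
    ((((hp1.pow 3).const_mul (4 / 3)).add (hp3.const_mul (2 / 3))).neg.congr fun n => by
      rw [Finset.sum_neg_distrib, sum_stepOp_two])
  have hR3 := hasSum_mzsvTerm_of_isKernelRep (List.append_ne_nil_of_left_ne_nil hne _)
    ((isKernelRep_block321 hm).block321_append hm)
    (summable_abs_stepOp hx (summable_abs_stepOp hx (summable_abs_stepOp hx hx2)))
    ((((hp1.pow 4).const_mul (2 / 3)).add ((hp1.const_mul (4 / 3)).mul hp3)).congr fun n =>
      (sum_stepOp_three _ n).symm)
  have h2 : (2 : ℝ) ^ (2 * m) = 2 * 2 ^ (2 * m - 1) := by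
    rw [← pow_succ']
    congr 1
    omega
  have h6 : 2 * (3 * m) = 6 * m := by ring
  have hpi4 : Real.pi ^ (4 * m) = (Real.pi ^ (2 * m)) ^ 2 := by rw [← pow_mul]; ring_nf
  have hpi6 : Real.pi ^ (6 * m) = (Real.pi ^ (2 * m)) ^ 3 := by rw [← pow_mul]; ring_nf
  have hpi8 : Real.pi ^ (8 * m) = (Real.pi ^ (2 * m)) ^ 4 := by rw [← pow_mul]; ring_nf
  have sq : ((-1 : ℝ) ^ m) ^ 2 = 1 := by rw [← pow_mul, mul_comm, pow_mul]; norm_num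
  have cube : (-1 : ℝ) ^ (3 * m) = (-1) ^ m := by rw [pow_mul]; norm_num
  have cube' : ((-1 : ℝ) ^ m) ^ 3 = (-1) ^ m := by rw [pow_succ, sq, one_mul]
  have four : ((-1 : ℝ) ^ m) ^ 4 = 1 := by rw [pow_succ, cube', ← pow_two, sq]
  rw [h6, cube] at hR2 hR3
  refine ⟨⟨hR1.summable, hR1.tsum_eq.trans ?_⟩, ⟨hR2.summable, hR2.tsum_eq.trans ?_⟩,
    ⟨hR3.summable, hR3.tsum_eq.trans ?_⟩⟩
  · rw [hpi4, h2]
    simp only [mul_pow, div_pow, sq]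
    ring
  · rw [hpi6, pow_succ (-1 : ℝ) m]
    simp only [mul_pow, div_pow, cube']
    ring
  · rw [hpi8, hpi6, h2]
    generalize (-1 : ℝ) ^ m = e at *
    generalize Real.pi ^ (2 * m) = p at *
    generalize (2 : ℝ) ^ (2 * m - 1) = t at *
    generalize (2 : ℝ) ^ (6 * m) = u at *
    simp only [mul_pow, div_pow, four]
    -- Only the p₁p₃ term still carries the square of the sign (-1)^m.
    linear_combination (4 / 3 * ((2 * t - 2) * (bernoulli (2 * m) : ℝ) /
      ((2 * m).factorial : ℝ) * p / 2) * ((u - 2) * (bernoulli (6 * m) : ℝ) /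
      ((6 * m).factorial : ℝ) * p ^ 3 / 2)) * sq
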